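/- Consider binary linear codes given by parity-check matrices, on the binary erasure channel with erasure probability $\varepsilon$ (BEC($\varepsilon$), capacity $1-\varepsilon$). No sparsity is needed, so LDPC codes are included. An $(n,k)$ code $\mathcal C$ may be a single code or a random code (an ensemble, i.e. a law on the parity-check matrices), with $0\le k\le n$. If $S$ is a set of positions, puncturing $\mathcal C$ at $S$ means that the bits in $S$ are not transmitted. The decoder works on the parity checks of $\mathcal C$, treats the bits in $S$ as missing, and has to recover all bits of the codeword, including those in $S$. Fix the decoder (iterative/peeling or optimal/MAP) and the failure measure (expected fraction of unrecovered bits, or probability that some bit is unrecovered), the same throughout. A family of $(n_i,k_i)$ codes, indexed along any filter (for instance a sequence), punctured at sets $S_i$ (possibly empty), with lengths $N_i=n_i-|S_i|$, is called capacity-achieving of rate $R$ if $N_i\to\infty$, $k_i/N_i\to R$, the dimension $D_i$ of the punctured code satisfies $\mathbb E|D_i-k_i|=o(N_i)$, and for every $0\le\varepsilon<1-R$ the failure measure on BEC($\varepsilon$), averaged over the ensemble, tends to $0$. Let $\mathcal C_i$ be a family of $(n_i,k_i)$ codes that is capacity-achieving of rate $R'\le\frac12$ (unpunctured), and put $R=\frac{R'}{1-R'}$.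 1. If the positions of the $\mathcal C_i$ are exchangeable, i.e. the law of the parity-check matrix is invariant under permutations of the columns, then for every choice of sets $S_i$ of $k_i$ positions the punctured codes, of lengths $n_i-k_i$, are capacity-achieving of rate $R$. 2. For arbitrary $\mathcal C_i$ (in particular for single codes) the same is true for almost every choice of $k_i$ positions: there are families $\mathcal G_i$ of $k_i$-element sets of positions, with $|\mathcal G_i|/\binom{n_i}{k_i}\to1$, such that the punctured codes are capacity-achieving of rate $R$ whenever $S_i\in\mathcal G_i$ eventually. 3. Conversely, for every choice of sets $S_i$ of $k_i$ positions and every $1-R<\varepsilon\le1$, the failure measure of the punctured codes on BEC($\varepsilon$) is eventually bounded below by a positive constant. -/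

import Mathlib

open Filter Topology

/-- The binary linear code with parity-check matrix `H` (rows are parity checks, columns are the
bits of the code). -/
def parityCode {m n : ℕ} (H : Matrix (Fin m) (Fin n) (ZMod 2)) :
    Submodule (ZMod 2) (Fin n → ZMod 2) :=
  LinearMap.ker H.mulVecLin

/-- The code obtained by puncturing (deleting) the positions in `S`: the projection of the code
onto the remaining positions. -/
def puncturedCode {m n : ℕ} (H : Matrix (Fin m) (Fin n) (ZMod 2)) (S : Finset (Fin n)) :
    Submodule (ZMod 2) ({j : Fin n // j ∉ S} → ZMod 2) :=
  (parityCode H).map (LinearMap.funLeft (ZMod 2) (ZMod 2) Subtype.val)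

/-- The bits known to the iterative erasure decoder (belief propagation, peeling) when the values
at the positions in `E` are missing: the received bits, and, repeatedly, every bit that lies in a
parity check all of whose other bits are known. -/
inductive PeelingRecovers {m n : ℕ} (H : Matrix (Fin m) (Fin n) (ZMod 2)) (E : Finset (Fin n)) :
    Fin n → Prop
  | received (j : Fin n) (hj : j ∉ E) : PeelingRecovers H E j
  | check (c : Fin m) (j : Fin n) (hj : H c j ≠ 0)
      (hc : ∀ j' : Fin n, j' ≠ j → H c j' ≠ 0 → PeelingRecovers H E j') : PeelingRecovers H E j

/-- Bit `j` is determined by the values of the codeword off `E`: two codewords that agree off `E`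
agree at `j`. -/
def MapRecovers {m n : ℕ} (H : Matrix (Fin m) (Fin n) (ZMod 2)) (E : Finset (Fin n))
    (j : Fin n) : Prop :=
  ∀ x ∈ parityCode H, ∀ y ∈ parityCode H, (∀ j' : Fin n, j' ∉ E → x j' = y j') → x j = y j

/-- The two standard decoders on the erasure channel. -/
inductive ErasureDecoder
  /-- iterative (belief propagation, peeling) decoding -/
  | iterative
  /-- optimal (maximum a posteriori) decoding -/
  | optimal

/-- The decoder recovers bit `j` of the codeword when the values at `E` are missing. -/
def ErasureDecoder.Recovers {m n : ℕ} (d : ErasureDecoder)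
    (H : Matrix (Fin m) (Fin n) (ZMod 2)) (E : Finset (Fin n)) (j : Fin n) : Prop :=
  match d with
  | .iterative => PeelingRecovers H E j
  | .optimal => MapRecovers H E j

open Classical in
/-- The bits that the decoder does not recover when the values at `E` are missing. -/
noncomputable def ErasureDecoder.unresolved {m n : ℕ} (d : ErasureDecoder)
    (H : Matrix (Fin m) (Fin n) (ZMod 2)) (E : Finset (Fin n)) : Finset (Fin n) :=
  Finset.univ.filter fun j => ¬ d.Recovers H E j

/-- The two standard measures of decoding failure. -/
inductive FailureCriterion
  /-- bit erasure rate -/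
  | bit
  /-- block erasure rate -/
  | block

open Classical in
/-- The loss for a set `U` of unresolved bits: the fraction of unresolved bits, or the indicator
that some bit is unresolved. -/
noncomputable def FailureCriterion.loss {n : ℕ} (c : FailureCriterion) (U : Finset (Fin n)) : ℝ :=
  match c with
  | .bit => (U.card : ℝ) / (n : ℝ)
  | .block => if U.Nonempty then 1 else 0

/-- The bits in `S` are punctured (not transmitted), and every other bit is sent over the binary
erasure channel with erasure probability `ε`, i.e. erased with probability `ε` independently of the
others; `E` is the set of erased bits. The decoder works on the parity checks of the whole code,
the values in `S ∪ E` are missing, and all bits of the codeword are to be recovered, including the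
punctured ones. This is the expected loss. -/
noncomputable def failureRate {m n : ℕ} (d : ErasureDecoder) (c : FailureCriterion)
    (H : Matrix (Fin m) (Fin n) (ZMod 2)) (S : Finset (Fin n)) (ε : ℝ) : ℝ :=
  ∑ E ∈ Sᶜ.powerset, ε ^ E.card * (1 - ε) ^ (Sᶜ \ E).card * c.loss (d.unresolved H (S ∪ E))

/-- A (possibly random) `(n, k)` code given by a parity-check matrix; a single code is the case
of a point mass `PMF.pure H`. The number `k` is the nominal dimension (for instance the
dimension of a single code, or the design dimension `n - m` of an ensemble). -/
structure CodeEnsemble where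
  /-- block length -/
  n : ℕ
  /-- number of parity checks -/
  m : ℕ
  /-- nominal dimension -/
  k : ℕ
  k_le : k ≤ n
  /-- the law of the parity-check matrix -/
  law : PMF (Matrix (Fin m) (Fin n) (ZMod 2))

namespace CodeEnsemble

/-- Expectation over the parity-check matrix. -/
noncomputable def expect (𝓒 : CodeEnsemble)
    (f : Matrix (Fin 𝓒.m) (Fin 𝓒.n) (ZMod 2) → ℝ) : ℝ :=
  ∑ H, (𝓒.law H).toReal * f H

/-- All positions of the code play the same role: the law of the parity-check matrix is invariant
under permutations of its columns. -/
def Exchangeable (𝓒 : CodeEnsemble) : Prop :=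
  ∀ σ : Equiv.Perm (Fin 𝓒.n),
    𝓒.law.map (fun H : Matrix (Fin 𝓒.m) (Fin 𝓒.n) (ZMod 2) => H.submatrix id σ) = 𝓒.law

end CodeEnsemble

/-- The codes `𝓒 i`, punctured at the positions `S i`, are capacity-achieving of rate `R` on the
binary erasure channel (whose capacity is `1 - ε`), as `i` runs along the filter `l`: the lengths
`N i = n i - |S i|` tend to infinity, the rates tend to `R` (`k i / N i → R`, and the dimension of
the punctured code is `k i` up to `o(N i)` in mean), and the failure rate tends to zero for every
erasure probability `ε < 1 - R`. -/
structure CapacityAchieving {ι : Type*} (l : Filter ι) (d : ErasureDecoder)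
    (c : FailureCriterion) (𝓒 : ι → CodeEnsemble) (S : ∀ i, Finset (Fin (𝓒 i).n)) (R : ℝ) :
    Prop where
  length : Tendsto (fun i => ((S i)ᶜ).card) l atTop
  rate : Tendsto (fun i => ((𝓒 i).k : ℝ) / (((S i)ᶜ).card : ℝ)) l (𝓝 R)
  dimension : Tendsto
    (fun i => (𝓒 i).expect (fun H =>
      |(Module.finrank (ZMod 2) (puncturedCode H (S i)) : ℝ) - ((𝓒 i).k : ℝ)|)
        / (((S i)ᶜ).card : ℝ)) l (𝓝 0)
  success : ∀ ε : ℝ, 0 ≤ ε → ε < 1 - R →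
    Tendsto (fun i => (𝓒 i).expect (fun H => failureRate d c H (S i) ε)) l (𝓝 0)

/-!
# Puncturing capacity-achieving codes on the binary erasure channel

For fixed `H`, the loss of the decoder is a function of the set `M` of missing positions only, with
values in `[0, 1]` and monotone in `M`; so is its mean over the ensemble. If the positions are
exchangeable, the mean loss is invariant under permutations and hence depends on `M` through `|M|`
alone (`le_of_card_le`). Puncturing `k ≈ R' n` positions and erasing the others with probability `ε`
leaves about `(R' + ε (1 - R')) n` positions missing. For `ε < 1 - R' / (1 - R')` this is less than
`ε' n` for some `ε' < 1 - R'`, and the number of erasures concentrates by Chebyshev's inequality, so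
the mean loss is at most that of the unpunctured code on the channel with erasure probability `ε'`,
up to `O(1 / n)` (`erasureMean_le_erasureMean_empty`).

For arbitrary codes the same applies to the average of the mean loss over all permutations of the
positions, which amounts to averaging over all punctured sets of size `k`
(`sum_powersetCard_div_choose`, `permAverage_erasureMean`). Markov's inequality, applied to a single
weighted sum of countably many failure rates and of the dimension defect, then gives one family of
good sets for all `ε` (`exists_subset_card_div_tendsto_one`). Countably many `ε` suffice since the
failure rate increases with `ε` (`erasureMean_mono_prob`).

Puncturing at `S` lowers the dimension by that of the subcode of codewords supported on `S`
(`finrank_puncturedCode_add_finrank_shortenedCode`). A codeword of this subcode is determined by its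
bits that remain unresolved when a subset `M ⊆ S` is missing, together with its bits on `S \ M`
(`finrank_shortenedCode_le`), and for `M` slightly smaller than `S` both are `o(n)` in number on
average (`tendsto_zero_of_le_add_card_sdiff`).

For the converse, `n - |M|` received bits carry at most `n - |M|` dimensions, so at least
`dim - (n - |M|)` bits are unresolved; the mean of this, divided by `n`, tends to a positive limit
when `ε > 1 - R' / (1 - R')` (`CodeEnsemble.le_expect_failureRate`).
-/

/-! ### The random erasure set -/

/-- The probability that the channel erases exactly the positions in `E`, out of those in `T`. -/
def erasureWeight {n : ℕ} (T : Finset (Fin n)) (ε : ℝ) (E : Finset (Fin n)) : ℝ :=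
  ε ^ E.card * (1 - ε) ^ (T \ E).card

lemma erasureWeight_nonneg {n : ℕ} (T : Finset (Fin n)) {ε : ℝ} (h0 : 0 ≤ ε) (h1 : ε ≤ 1)
    (E : Finset (Fin n)) : 0 ≤ erasureWeight T ε E :=
  mul_nonneg (pow_nonneg h0 _) (pow_nonneg (by linarith) _)

/-- The number of erased positions has a binomial law. -/
lemma sum_erasureWeight_mul_card {n : ℕ} (T : Finset (Fin n)) (ε : ℝ) (f : ℕ → ℝ) :
    ∑ E ∈ T.powerset, erasureWeight T ε E * f E.card =
      ∑ ν ∈ Finset.range (T.card + 1), (bernsteinPolynomial ℝ T.card ν).eval ε * f ν := by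
  have h : ∀ E ∈ T.powerset, erasureWeight T ε E * f E.card =
      (fun ν => ε ^ ν * (1 - ε) ^ (T.card - ν) * f ν) E.card := by
    intro E hE
    simp only [erasureWeight, Finset.card_sdiff_of_subset (Finset.mem_powerset.1 hE)]
  rw [Finset.sum_congr rfl h, Finset.sum_powerset_apply_card
    (fun ν => ε ^ ν * (1 - ε) ^ (T.card - ν) * f ν)]
  refine Finset.sum_congr rfl fun ν _ => ?_
  simp [bernsteinPolynomial]
  ring

lemma sum_erasureWeight {n : ℕ} (T : Finset (Fin n)) (ε : ℝ) :
    ∑ E ∈ T.powerset, erasureWeight T ε E = 1 := by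
  have h := sum_erasureWeight_mul_card T ε (fun _ => 1)
  have hb := congrArg (Polynomial.eval ε) (bernsteinPolynomial.sum ℝ T.card)
  simp only [mul_one] at h
  rw [h, ← Polynomial.eval_finsetSum, hb, Polynomial.eval_one]

lemma sum_erasureWeight_card {n : ℕ} (T : Finset (Fin n)) (ε : ℝ) :
    ∑ E ∈ T.powerset, erasureWeight T ε E * (E.card : ℝ) = ε * T.card := by
  have hb := congrArg (Polynomial.eval ε) (bernsteinPolynomial.sum_smul ℝ T.card)
  rw [sum_erasureWeight_mul_card T ε (fun ν => (ν : ℝ))]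
  simp only [Polynomial.eval_finsetSum, nsmul_eq_mul, Polynomial.eval_mul, Polynomial.eval_natCast,
    Polynomial.eval_X] at hb
  rw [mul_comm ε, ← hb]
  exact Finset.sum_congr rfl fun _ _ => mul_comm _ _

/-- A bound on the variance of the number of erased positions. -/
lemma sum_erasureWeight_sq_le {n : ℕ} (T : Finset (Fin n)) {ε : ℝ} (h0 : 0 ≤ ε) (h1 : ε ≤ 1) :
    ∑ E ∈ T.powerset, erasureWeight T ε E * ((E.card : ℝ) - ε * T.card) ^ 2 ≤ T.card := by
  have hb := congrArg (Polynomial.eval ε) (bernsteinPolynomial.variance ℝ T.card)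
  rw [sum_erasureWeight_mul_card T ε (fun ν => ((ν : ℝ) - ε * T.card) ^ 2)]
  simp only [Polynomial.eval_finsetSum, nsmul_eq_mul, Polynomial.eval_mul, Polynomial.eval_natCast,
    Polynomial.eval_X, Polynomial.eval_pow, Polynomial.eval_sub, Polynomial.eval_one] at hb
  calc _ = (T.card : ℝ) * ε * (1 - ε) := by
        rw [← hb]
        exact Finset.sum_congr rfl fun _ _ => by ring
    _ ≤ T.card := by
        have hT : (0 : ℝ) ≤ T.card := Nat.cast_nonneg _
        nlinarith [mul_nonneg hT (by nlinarith : 0 ≤ 1 - ε * (1 - ε))]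

/-- The mean of `ψ` over the set of missing positions, when those in `S` are punctured and the
others are erased independently with probability `ε`. -/
def erasureMean {n : ℕ} (ψ : Finset (Fin n) → ℝ) (S : Finset (Fin n)) (ε : ℝ) : ℝ :=
  ∑ E ∈ Sᶜ.powerset, erasureWeight Sᶜ ε E * ψ (S ∪ E)

section erasureMean

variable {n : ℕ} {ψ φ : Finset (Fin n) → ℝ} {ε : ℝ}

lemma erasureMean_nonneg (h0 : 0 ≤ ε) (h1 : ε ≤ 1) (hψ : ∀ M, 0 ≤ ψ M) (S : Finset (Fin n)) :
    0 ≤ erasureMean ψ S ε :=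
  Finset.sum_nonneg fun E _ => mul_nonneg (erasureWeight_nonneg _ h0 h1 E) (hψ _)

lemma erasureMean_mono (h0 : 0 ≤ ε) (h1 : ε ≤ 1) (h : ∀ M, ψ M ≤ φ M) (S : Finset (Fin n)) :
    erasureMean ψ S ε ≤ erasureMean φ S ε :=
  Finset.sum_le_sum fun E _ => mul_le_mul_of_nonneg_left (h _) (erasureWeight_nonneg _ h0 h1 E)

lemma erasureMean_const (a : ℝ) (S : Finset (Fin n)) : erasureMean (fun _ => a) S ε = a := by
  rw [erasureMean, ← Finset.sum_mul, sum_erasureWeight, one_mul]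

lemma erasureMean_le_one (h0 : 0 ≤ ε) (h1 : ε ≤ 1) (hψ : ∀ M, ψ M ≤ 1) (S : Finset (Fin n)) :
    erasureMean ψ S ε ≤ 1 :=
  (erasureMean_mono h0 h1 hψ S).trans_eq (erasureMean_const 1 S)

lemma erasureMean_zero (ψ : Finset (Fin n) → ℝ) (S : Finset (Fin n)) :
    erasureMean ψ S 0 = ψ S := by
  rw [erasureMean, Finset.sum_eq_single ∅]
  · simp [erasureWeight]
  · intro E _ hE
    simp [erasureWeight, hE]
  · simp

/-- On the left the set of missing positions has mean size at most `τ * n`, on the right `τ₂ * n`.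
By Chebyshev's inequality the first has size at most `τ₁ * n`, and the second at least `τ₁ * n`, up
to the error terms; `ψ` depends on the size alone and increases with it. -/
lemma erasureMean_le_erasureMean_empty (hn : 0 < n)
    (hcard : ∀ M M' : Finset (Fin n), M.card ≤ M'.card → ψ M ≤ ψ M')
    (hψ0 : ∀ M, 0 ≤ ψ M) (hψ1 : ∀ M, ψ M ≤ 1) (S : Finset (Fin n)) (h0 : 0 ≤ ε) (h1 : ε ≤ 1)
    {τ τ₁ τ₂ : ℝ} (hτ0 : 0 ≤ τ) (hτ₁ : τ < τ₁) (hτ₂ : τ₁ < τ₂) (hτ₂1 : τ₂ ≤ 1)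
    (hS : (S.card : ℝ) + ε * (Sᶜ.card : ℝ) ≤ τ * n) :
    erasureMean ψ S ε ≤ erasureMean ψ ∅ τ₂ + (1 / (τ₂ - τ₁) ^ 2 + 1 / (τ₁ - τ) ^ 2) / n := by
  have hn' : (0 : ℝ) < n := Nat.cast_pos.2 hn
  have hτ₁0 : 0 ≤ τ₁ * n := mul_nonneg (by linarith) hn'.le
  -- a set at the threshold size `τ₁ * n` separates the two sides
  obtain ⟨T, -, hT⟩ := Finset.exists_subset_card_eq
    (s := (Finset.univ : Finset (Fin n))) (n := ⌊τ₁ * n⌋₊) (by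
      rw [Finset.card_univ, Fintype.card_fin]
      refine Nat.floor_le_of_le ?_
      nlinarith)
  have cheb : ∀ {a δ : ℝ}, 0 < δ → δ * n ≤ |a| → 1 ≤ a ^ 2 * (1 / (δ * n) ^ 2) := by
    intro a δ hδ ha
    have hp : 0 < δ * n := mul_pos hδ hn'
    rw [mul_one_div, one_le_div (by positivity), ← sq_abs a]
    exact pow_le_pow_left₀ hp.le ha 2
  have hupper : erasureMean ψ S ε ≤ ψ T + 1 / (τ₁ - τ) ^ 2 / n := by
    have hpt : ∀ E ∈ Sᶜ.powerset, erasureWeight Sᶜ ε E * ψ (S ∪ E) ≤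
        erasureWeight Sᶜ ε E * ψ T + erasureWeight Sᶜ ε E * ((E.card : ℝ) - ε * Sᶜ.card) ^ 2 *
          (1 / ((τ₁ - τ) * n) ^ 2) := by
      intro E _
      rw [mul_assoc, ← mul_add]
      refine mul_le_mul_of_nonneg_left ?_ (erasureWeight_nonneg _ h0 h1 E)
      by_cases hc : (S ∪ E).card ≤ T.card
      · have := hcard _ _ hc
        have : 0 ≤ ((E.card : ℝ) - ε * Sᶜ.card) ^ 2 * (1 / ((τ₁ - τ) * n) ^ 2) := by positivity
        linarith
      · push Not at hc
        rw [hT, Nat.floor_lt hτ₁0] at hc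
        have hu : ((S ∪ E).card : ℝ) ≤ S.card + E.card := by
          exact_mod_cast Finset.card_union_le S E
        have := cheb (a := (E.card : ℝ) - ε * Sᶜ.card) (sub_pos.2 hτ₁)
          (le_trans (by linarith) (le_abs_self _))
        linarith [hψ1 (S ∪ E), hψ0 T]
    refine (Finset.sum_le_sum hpt).trans ?_
    rw [Finset.sum_add_distrib, ← Finset.sum_mul, ← Finset.sum_mul, sum_erasureWeight, one_mul]
    have hv : ∑ E ∈ Sᶜ.powerset, erasureWeight Sᶜ ε E * ((E.card : ℝ) - ε * Sᶜ.card) ^ 2 ≤ n :=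
      (sum_erasureWeight_sq_le _ h0 h1).trans
        (by exact_mod_cast (Finset.card_le_univ Sᶜ).trans_eq (Fintype.card_fin n))
    have := mul_le_mul_of_nonneg_right hv
      (by positivity : 0 ≤ 1 / ((τ₁ - τ) * (n : ℝ)) ^ 2)
    refine add_le_add le_rfl (this.trans_eq ?_)
    have : τ₁ - τ ≠ 0 := (sub_pos.2 hτ₁).ne'
    field_simp
  have hlower : ψ T ≤ erasureMean ψ ∅ τ₂ + 1 / (τ₂ - τ₁) ^ 2 / n := by
    have h20 : 0 ≤ τ₂ := by linarith
    have hpt : ∀ E ∈ (∅ : Finset (Fin n))ᶜ.powerset, erasureWeight ∅ᶜ τ₂ E * ψ T ≤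
        erasureWeight ∅ᶜ τ₂ E * ψ (∅ ∪ E) +
          erasureWeight ∅ᶜ τ₂ E * ((E.card : ℝ) - τ₂ * (∅ᶜ : Finset (Fin n)).card) ^ 2 *
          (1 / ((τ₂ - τ₁) * n) ^ 2) := by
      intro E _
      rw [mul_assoc, ← mul_add]
      refine mul_le_mul_of_nonneg_left ?_ (erasureWeight_nonneg _ h20 hτ₂1 E)
      by_cases hc : T.card ≤ (∅ ∪ E).card
      · have := hcard _ _ hc
        have : 0 ≤ ((E.card : ℝ) - τ₂ * (∅ᶜ : Finset (Fin n)).card) ^ 2 *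
          (1 / ((τ₂ - τ₁) * n) ^ 2) := by positivity
        linarith
      · push Not at hc
        rw [hT, Finset.empty_union] at hc
        have hc' : (E.card : ℝ) ≤ τ₁ * n := (Nat.cast_le.2 hc.le).trans (Nat.floor_le hτ₁0)
        have := cheb (a := (E.card : ℝ) - τ₂ * (∅ᶜ : Finset (Fin n)).card) (sub_pos.2 hτ₂)
          (le_trans (by simp; linarith) (neg_le_abs _))
        linarith [hψ1 T, hψ0 (∅ ∪ E)]
    have hs := Finset.sum_le_sum hpt
    rw [Finset.sum_add_distrib, ← Finset.sum_mul, ← Finset.sum_mul, sum_erasureWeight,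
      one_mul] at hs
    have hv : ∑ E ∈ (∅ : Finset (Fin n))ᶜ.powerset, erasureWeight ∅ᶜ τ₂ E *
        ((E.card : ℝ) - τ₂ * (∅ᶜ : Finset (Fin n)).card) ^ 2 ≤ n :=
      (sum_erasureWeight_sq_le _ h20 hτ₂1).trans (by simp)
    have := mul_le_mul_of_nonneg_right hv
      (by positivity : 0 ≤ 1 / ((τ₂ - τ₁) * (n : ℝ)) ^ 2)
    refine hs.trans (add_le_add le_rfl (this.trans_eq ?_))
    have : τ₂ - τ₁ ≠ 0 := (sub_pos.2 hτ₂).ne'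
    field_simp
  rw [add_div]
  linarith

/-- By induction on `T`, conditioning on whether the last position is erased. -/
lemma sum_erasureWeight_mul_mono (hψ : Monotone ψ) (h0 : 0 ≤ ε) {ε' : ℝ} (hε : ε ≤ ε')
    (h1 : ε' ≤ 1) (T : Finset (Fin n)) (S : Finset (Fin n)) :
    ∑ E ∈ T.powerset, erasureWeight T ε E * ψ (S ∪ E) ≤
      ∑ E ∈ T.powerset, erasureWeight T ε' E * ψ (S ∪ E) := by
  induction T using Finset.induction_on generalizing S with
  | empty => simp [erasureWeight]
  | insert a T ha ih =>
    have hrec : ∀ p : ℝ, ∑ E ∈ (insert a T).powerset, erasureWeight (insert a T) p E * ψ (S ∪ E) =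
        (1 - p) * ∑ E ∈ T.powerset, erasureWeight T p E * ψ (S ∪ E) +
          p * ∑ E ∈ T.powerset, erasureWeight T p E * ψ (insert a S ∪ E) := by
      intro p
      rw [Finset.sum_powerset_insert ha, Finset.mul_sum, Finset.mul_sum]
      congr 1 <;> refine Finset.sum_congr rfl fun E hE => ?_
      · have haE : a ∉ E := fun h => ha (Finset.mem_powerset.1 hE h)
        rw [erasureWeight, erasureWeight, Finset.insert_sdiff_of_notMem _ haE,
          Finset.card_insert_of_notMem (by simp [ha])]
        ring
      · have haE : a ∉ E := fun h => ha (Finset.mem_powerset.1 hE h)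
        rw [erasureWeight, erasureWeight, Finset.insert_sdiff_insert,
          Finset.sdiff_insert_of_notMem ha, Finset.card_insert_of_notMem haE,
          Finset.union_insert, Finset.insert_union]
        ring
    rw [hrec, hrec]
    have hins : ∑ E ∈ T.powerset, erasureWeight T ε' E * ψ (S ∪ E) ≤
        ∑ E ∈ T.powerset, erasureWeight T ε' E * ψ (insert a S ∪ E) :=
      Finset.sum_le_sum fun E _ => mul_le_mul_of_nonneg_left
        (hψ (Finset.union_subset_union_left (Finset.subset_insert a S)))
        (erasureWeight_nonneg T (h0.trans hε) h1 E)
    nlinarith [mul_le_mul_of_nonneg_left (ih S) (by linarith : 0 ≤ 1 - ε),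
      mul_le_mul_of_nonneg_left (ih (insert a S)) h0,
      mul_le_mul_of_nonneg_left hins (sub_nonneg.2 hε)]

lemma erasureMean_mono_prob (hψ : Monotone ψ) (h0 : 0 ≤ ε) {ε' : ℝ} (hε : ε ≤ ε') (h1 : ε' ≤ 1)
    (S : Finset (Fin n)) : erasureMean ψ S ε ≤ erasureMean ψ S ε' :=
  sum_erasureWeight_mul_mono hψ h0 hε h1 Sᶜ S

end erasureMean

/-- If `ψ` vanishes in mean for every erasure probability below `θ`, then it does so for punctured
sets and erasures that together miss a fraction of the positions below `θ` in mean. -/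
lemma tendsto_erasureMean {ι : Type*} {l : Filter ι} [l.NeBot] {n : ι → ℕ}
    {ψ : ∀ i, Finset (Fin (n i)) → ℝ}
    (hcard : ∀ i, ∀ M M' : Finset (Fin (n i)), M.card ≤ M'.card → ψ i M ≤ ψ i M')
    (hψ0 : ∀ i M, 0 ≤ ψ i M) (hψ1 : ∀ i M, ψ i M ≤ 1) (hn : Tendsto n l atTop) {θ : ℝ}
    (hθ : θ ≤ 1)
    (hlim : ∀ ε, 0 ≤ ε → ε < θ → Tendsto (fun i => erasureMean (ψ i) ∅ ε) l (𝓝 0))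
    (S : ∀ i, Finset (Fin (n i))) {ε τ : ℝ} (h0 : 0 ≤ ε) (h1 : ε ≤ 1) (hτ : τ < θ)
    (hS : ∀ᶠ i in l, ((S i).card : ℝ) + ε * ((S i)ᶜ.card : ℝ) ≤ τ * n i) :
    Tendsto (fun i => erasureMean (ψ i) (S i) ε) l (𝓝 0) := by
  have hpos : ∀ᶠ i in l, 0 < n i := hn.eventually_gt_atTop 0
  have hτ0 : 0 ≤ τ := by
    obtain ⟨i, hi, hi'⟩ := (hS.and hpos).exists
    have : (0 : ℝ) < n i := Nat.cast_pos.2 hi'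
    have : 0 ≤ τ * n i := le_trans (by positivity) hi
    by_contra! h
    nlinarith
  obtain ⟨τ₂, hτ₂, hτ₂θ⟩ := exists_between hτ
  obtain ⟨τ₁, hτ₁, hτ₁₂⟩ := exists_between hτ₂
  have hcast : Tendsto (fun i => (n i : ℝ)) l atTop := tendsto_natCast_atTop_atTop.comp hn
  have hup := (hlim τ₂ (by linarith) hτ₂θ).add
    (hcast.const_div_atTop (1 / (τ₂ - τ₁) ^ 2 + 1 / (τ₁ - τ) ^ 2))
  rw [add_zero] at hup
  refine squeeze_zero' (Eventually.of_forall fun i => erasureMean_nonneg h0 h1 (hψ0 i) _) ?_ hup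
  filter_upwards [hS, hpos] with i hi hi'
  exact erasureMean_le_erasureMean_empty hi' (hcard i) (hψ0 i) (hψ1 i) (S i) h0 h1 hτ0 hτ₁ hτ₁₂
    (by linarith) hi

/-! ### Averaging over the permutations of the positions -/

/-- The average of `F` over the images of a set of positions under all permutations. -/
noncomputable def permAverage {n : ℕ} (F : Finset (Fin n) → ℝ) (M : Finset (Fin n)) : ℝ :=
  (∑ σ : Equiv.Perm (Fin n), F (M.map σ.toEmbedding)) / Fintype.card (Equiv.Perm (Fin n))

section permAverage

variable {n : ℕ} {F G : Finset (Fin n) → ℝ}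

lemma exists_perm_map_eq {M M' : Finset (Fin n)} (h : M.card = M'.card) :
    ∃ σ : Equiv.Perm (Fin n), M.map σ.toEmbedding = M' := by
  have e : {x // x ∈ M} ≃ {x // x ∈ M'} := Finset.equivOfCardEq h
  refine ⟨e.extendSubtype, Finset.eq_of_subset_of_card_le ?_ (by rw [Finset.card_map, h])⟩
  intro x hx
  obtain ⟨y, hy, rfl⟩ := Finset.mem_map.1 hx
  exact e.extendSubtype_mem y hy

lemma le_of_card_le (hmono : Monotone F)
    (hinv : ∀ (σ : Equiv.Perm (Fin n)) M, F (M.map σ.toEmbedding) = F M)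
    (M M' : Finset (Fin n)) (h : M.card ≤ M'.card) : F M ≤ F M' := by
  obtain ⟨T, hT, hTc⟩ := Finset.exists_subset_card_eq h
  obtain ⟨σ, rfl⟩ := exists_perm_map_eq hTc.symm
  exact (hinv σ M).symm.le.trans (hmono hT)

lemma permAverage_map (σ : Equiv.Perm (Fin n)) (M : Finset (Fin n)) :
    permAverage F (M.map σ.toEmbedding) = permAverage F M := by
  rw [permAverage, permAverage]
  congr 1
  refine Fintype.sum_equiv (Equiv.mulRight σ) _ _ fun ρ => ?_
  rw [Finset.map_map]
  rfl

lemma permAverage_const (a : ℝ) (M : Finset (Fin n)) : permAverage (fun _ => a) M = a := by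
  rw [permAverage, Finset.sum_const, Finset.card_univ, nsmul_eq_mul,
    mul_div_cancel_left₀ _ (Nat.cast_ne_zero.2 Fintype.card_ne_zero)]

lemma permAverage_le_permAverage {M M' : Finset (Fin n)}
    (h : ∀ σ : Equiv.Perm (Fin n), F (M.map σ.toEmbedding) ≤ G (M'.map σ.toEmbedding)) :
    permAverage F M ≤ permAverage G M' :=
  div_le_div_of_nonneg_right (Finset.sum_le_sum fun σ _ => h σ) (Nat.cast_nonneg _)

lemma permAverage_add_const (a : ℝ) (M : Finset (Fin n)) :
    permAverage (fun M => F M + a) M = permAverage F M + a := by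
  conv_rhs => rw [← permAverage_const a M]
  simp only [permAverage, Finset.sum_add_distrib, add_div]

lemma permAverage_mono (h : Monotone F) : Monotone (permAverage F) := fun _ _ hM =>
  permAverage_le_permAverage fun _ => h (Finset.map_subset_map.2 hM)

lemma permAverage_nonneg (h : ∀ M, 0 ≤ F M) (M : Finset (Fin n)) : 0 ≤ permAverage F M :=
  div_nonneg (Finset.sum_nonneg fun _ _ => h _) (Nat.cast_nonneg _)

lemma permAverage_le_one (h : ∀ M, F M ≤ 1) (M : Finset (Fin n)) : permAverage F M ≤ 1 :=
  (permAverage_le_permAverage (G := fun _ => 1) (M' := M) fun _ => h _).trans_eq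
    (permAverage_const 1 M)

/-- Averaging over all sets of a given size is the same as averaging over the images of one such
set under all permutations. -/
lemma sum_powersetCard_div_choose (F : Finset (Fin n) → ℝ) (S : Finset (Fin n)) :
    (∑ T ∈ Finset.powersetCard S.card Finset.univ, F T) / (n.choose S.card : ℝ) =
      permAverage F S := by
  have hperm : ∀ σ : Equiv.Perm (Fin n),
      ∑ T ∈ Finset.powersetCard S.card Finset.univ, F (T.map σ.toEmbedding) =
        ∑ T ∈ Finset.powersetCard S.card Finset.univ, F T := by
    intro σ
    conv_rhs => rw [← Finset.map_univ_equiv σ, Finset.powersetCard_map, Finset.sum_map]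
    rfl
  have hconst : ∀ T ∈ Finset.powersetCard S.card (Finset.univ : Finset (Fin n)),
      permAverage F T = permAverage F S := by
    intro T hT
    obtain ⟨σ, rfl⟩ := exists_perm_map_eq (Finset.mem_powersetCard.1 hT).2.symm
    exact permAverage_map σ S
  have hsum : ∑ T ∈ Finset.powersetCard S.card Finset.univ, permAverage F T =
      ∑ T ∈ Finset.powersetCard S.card Finset.univ, F T := by
    simp only [permAverage]
    rw [← Finset.sum_div, Finset.sum_comm, Finset.sum_congr rfl fun σ _ => hperm σ,
      Finset.sum_const, Finset.card_univ, nsmul_eq_mul,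
      mul_div_cancel_left₀ _ (Nat.cast_ne_zero.2 Fintype.card_ne_zero)]
  rw [← hsum, Finset.sum_congr rfl hconst, Finset.sum_const, Finset.card_powersetCard,
    Finset.card_univ, Fintype.card_fin, nsmul_eq_mul, mul_div_cancel_left₀]
  exact Nat.cast_ne_zero.2 (Nat.choose_pos (card_finset_fin_le S)).ne'

lemma erasureMean_map (ψ : Finset (Fin n) → ℝ) (S : Finset (Fin n)) (ε : ℝ)
    (σ : Equiv.Perm (Fin n)) :
    erasureMean ψ (S.map σ.toEmbedding) ε =
      erasureMean (fun M => ψ (M.map σ.toEmbedding)) S ε := by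
  have hc : (S.map σ.toEmbedding)ᶜ = Sᶜ.map σ.toEmbedding := by
    ext x
    simp [Finset.mem_map_equiv]
  rw [erasureMean, erasureMean, hc]
  refine (Finset.sum_equiv (Equiv.finsetCongr σ) (fun E => ?_) fun E _ => ?_).symm
  · simp [Finset.mem_powerset]
  · simp only [erasureWeight, Equiv.finsetCongr_apply, Finset.map_union, Finset.card_map,
      ← Finset.map_sdiff]

/-- Averaging over a uniformly random punctured set commutes with the mean over the erasures. -/
lemma permAverage_erasureMean (ψ : Finset (Fin n) → ℝ) (S : Finset (Fin n)) (ε : ℝ) :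
    permAverage (fun S => erasureMean ψ S ε) S = erasureMean (permAverage ψ) S ε := by
  simp only [permAverage, erasureMean_map]
  simp only [erasureMean]
  rw [Finset.sum_comm, Finset.sum_div]
  refine Finset.sum_congr rfl fun E _ => ?_
  rw [← Finset.mul_sum, mul_div_assoc]
  rfl

end permAverage

/-! ### Decoding from a set of missing positions -/

section decoding

variable {m n : ℕ} {H : Matrix (Fin m) (Fin n) (ZMod 2)} {E E' : Finset (Fin n)}

lemma mem_parityCode {x : Fin n → ZMod 2} :
    x ∈ parityCode H ↔ ∀ c, ∑ j, H c j * x j = 0 := by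
  rw [parityCode, LinearMap.mem_ker, Matrix.mulVecLin_apply, funext_iff]
  rfl

/-- Peeling is sound: whatever it recovers is determined by the received bits. -/
lemma PeelingRecovers.mapRecovers {j : Fin n} (h : PeelingRecovers H E j) :
    MapRecovers H E j := by
  intro x hx y hy hxy
  induction h with
  | received j hj => exact hxy j hj
  | check c j hj _ ih =>
    have hx' := mem_parityCode.1 hx c
    have hy' := mem_parityCode.1 hy c
    rw [← Finset.add_sum_erase _ _ (Finset.mem_univ j)] at hx' hy'
    have hrest : ∑ j' ∈ Finset.univ.erase j, H c j' * x j' =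
        ∑ j' ∈ Finset.univ.erase j, H c j' * y j' := by
      refine Finset.sum_congr rfl fun j' hj' => ?_
      by_cases h0 : H c j' = 0
      · rw [h0, zero_mul, zero_mul]
      · rw [ih j' (Finset.ne_of_mem_erase hj') h0]
    rw [hrest] at hx'
    exact mul_left_cancel₀ hj (add_right_cancel (hx'.trans hy'.symm))

lemma ErasureDecoder.Recovers.mapRecovers {d : ErasureDecoder} {j : Fin n}
    (h : d.Recovers H E j) : MapRecovers H E j := by
  cases d with
  | iterative => exact PeelingRecovers.mapRecovers h
  | optimal => exact h

lemma ErasureDecoder.Recovers.anti {d : ErasureDecoder} {j : Fin n} (hE : E ⊆ E')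
    (h : d.Recovers H E' j) : d.Recovers H E j := by
  cases d with
  | iterative =>
    induction (show PeelingRecovers H E' j from h) with
    | received j hj => exact .received j fun hj' => hj (hE hj')
    | check c j hj hc ih => exact .check c j hj fun j' hj' h' => ih j' hj' h' (hc j' hj' h')
  | optimal => exact fun x hx y hy hxy => h x hx y hy fun j' hj' => hxy j' fun h' => hj' (hE h')

lemma ErasureDecoder.Recovers.of_submatrix {d : ErasureDecoder} {σ : Equiv.Perm (Fin n)}
    {j : Fin n} (h : d.Recovers (H.submatrix id σ) E j) :
    d.Recovers H (E.map σ.toEmbedding) (σ j) := by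
  cases d with
  | iterative =>
    induction (show PeelingRecovers (H.submatrix id σ) E j from h) with
    | received j hj => exact .received _ (by simpa using hj)
    | check c j hj hc ih =>
      refine .check c (σ j) hj fun j' hj' h' => ?_
      have h1 : σ.symm j' ≠ j := fun he => hj' (by rw [← he, σ.apply_symm_apply])
      have h2 : (H.submatrix id σ) c (σ.symm j') ≠ 0 := by simpa using h'
      have := ih (σ.symm j') h1 h2 (hc _ h1 h2)
      rwa [σ.apply_symm_apply] at this
  | optimal =>
    have hcode : ∀ x ∈ parityCode H, x ∘ σ ∈ parityCode (H.submatrix id σ) := by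
      intro x hx
      rw [mem_parityCode] at hx ⊢
      intro c
      rw [← hx c]
      exact Equiv.sum_comp σ fun j => H c j * x j
    exact fun x hx y hy hxy => h _ (hcode x hx) _ (hcode y hy) fun j' hj' =>
      hxy _ (by simpa using hj')

lemma ErasureDecoder.recovers_submatrix {d : ErasureDecoder} {σ : Equiv.Perm (Fin n)}
    {j : Fin n} :
    d.Recovers (H.submatrix id σ) E j ↔ d.Recovers H (E.map σ.toEmbedding) (σ j) := by
  refine ⟨fun h => h.of_submatrix, fun h => ?_⟩
  have hH : H = (H.submatrix id σ).submatrix id σ.symm := by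
    ext
    simp
  rw [hH] at h
  have := h.of_submatrix
  rw [σ.symm_apply_apply, Finset.map_map] at this
  convert this
  ext
  simp

lemma ErasureDecoder.mem_unresolved {d : ErasureDecoder} {j : Fin n} :
    j ∈ d.unresolved H E ↔ ¬ d.Recovers H E j := by
  simp [ErasureDecoder.unresolved]

lemma ErasureDecoder.unresolved_mono (d : ErasureDecoder)
    (H : Matrix (Fin m) (Fin n) (ZMod 2)) : Monotone (d.unresolved H) := by
  intro E E' hE j
  rw [ErasureDecoder.mem_unresolved, ErasureDecoder.mem_unresolved]
  exact mt fun h => h.anti hE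

lemma ErasureDecoder.unresolved_submatrix (d : ErasureDecoder) (σ : Equiv.Perm (Fin n)) :
    (d.unresolved (H.submatrix id σ) E).map σ.toEmbedding =
      d.unresolved H (E.map σ.toEmbedding) := by
  ext j
  rw [Finset.mem_map_equiv, ErasureDecoder.mem_unresolved, ErasureDecoder.mem_unresolved,
    ErasureDecoder.recovers_submatrix, σ.apply_symm_apply]

end decoding

namespace FailureCriterion

variable {n : ℕ} (c : FailureCriterion)

lemma loss_nonneg (U : Finset (Fin n)) : 0 ≤ c.loss U := by
  cases c with
  | bit => exact div_nonneg (Nat.cast_nonneg _) (Nat.cast_nonneg _)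
  | block =>
    simp only [loss]
    split_ifs <;> norm_num

lemma loss_le_one (U : Finset (Fin n)) : c.loss U ≤ 1 := by
  cases c with
  | bit => exact div_le_one_of_le₀ (Nat.cast_le.2 (card_finset_fin_le U)) (Nat.cast_nonneg _)
  | block =>
    simp only [loss]
    split_ifs <;> norm_num

lemma loss_mono : Monotone (c.loss (n := n)) := by
  intro U V hUV
  cases c with
  | bit =>
    have h : (U.card : ℝ) ≤ V.card := Nat.cast_le.2 (Finset.card_le_card hUV)
    exact div_le_div_of_nonneg_right h (Nat.cast_nonneg _)
  | block =>
    by_cases hU : U.Nonempty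
    · simp [loss, hU, hU.mono hUV]
    · simpa [loss, hU] using loss_nonneg .block V

lemma loss_map (U : Finset (Fin n)) (σ : Equiv.Perm (Fin n)) :
    c.loss (U.map σ.toEmbedding) = c.loss U := by
  cases c <;> simp [loss]

/-- Both losses are at least the fraction of unresolved bits. -/
lemma card_div_le_loss (U : Finset (Fin n)) : (U.card : ℝ) / n ≤ c.loss U := by
  cases c with
  | bit => exact le_rfl
  | block =>
    rcases U.eq_empty_or_nonempty with rfl | hU
    · simp [loss]
    · simpa [loss, hU] using loss_le_one .bit U

end FailureCriterion

/-! ### Dimensions of punctured and shortened codes -/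

/-- The codewords that vanish off `M`. Its dimension is what puncturing at `M` loses. -/
def shortenedCode {m n : ℕ} (H : Matrix (Fin m) (Fin n) (ZMod 2)) (M : Finset (Fin n)) :
    Submodule (ZMod 2) (Fin n → ZMod 2) :=
  parityCode H ⊓ LinearMap.ker
    (LinearMap.funLeft (ZMod 2) (ZMod 2) (Subtype.val : {j : Fin n // j ∉ M} → Fin n))

section dimension

variable {m n : ℕ} (H : Matrix (Fin m) (Fin n) (ZMod 2))

lemma mem_shortenedCode {H : Matrix (Fin m) (Fin n) (ZMod 2)} {M : Finset (Fin n)}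
    {x : Fin n → ZMod 2} :
    x ∈ shortenedCode H M ↔ x ∈ parityCode H ∧ ∀ j, j ∉ M → x j = 0 := by
  rw [shortenedCode, Submodule.mem_inf, LinearMap.mem_ker, funext_iff, Subtype.forall]
  rfl

lemma finrank_puncturedCode_add_finrank_shortenedCode (M : Finset (Fin n)) :
    Module.finrank (ZMod 2) (puncturedCode H M) + Module.finrank (ZMod 2) (shortenedCode H M) =
      Module.finrank (ZMod 2) (parityCode H) := by
  rw [← LinearMap.finrank_range_add_finrank_ker ((LinearMap.funLeft (ZMod 2) (ZMod 2)
    (Subtype.val : {j : Fin n // j ∉ M} → Fin n)).domRestrict (parityCode H)),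
    LinearMap.range_domRestrict, LinearMap.ker_domRestrict, shortenedCode,
    ← Submodule.map_comap_subtype, Submodule.finrank_map_subtype_eq]
  rfl

lemma finrank_puncturedCode_le (M : Finset (Fin n)) :
    Module.finrank (ZMod 2) (puncturedCode H M) ≤ Mᶜ.card := by
  refine (Submodule.finrank_le _).trans_eq ?_
  rw [Module.finrank_pi, Fintype.card_of_subtype Mᶜ fun _ => Finset.mem_compl]

lemma finrank_le_card_of_forall_eq_zero (W : Submodule (ZMod 2) (Fin n → ZMod 2))
    (T : Finset (Fin n)) (h : ∀ x ∈ W, (∀ j ∈ T, x j = 0) → x = 0) :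
    Module.finrank (ZMod 2) W ≤ T.card := by
  have hinj : Function.Injective ((LinearMap.funLeft (ZMod 2) (ZMod 2)
      (Subtype.val : {j : Fin n // j ∈ T} → Fin n)).domRestrict W) := by
    rw [injective_iff_map_eq_zero]
    intro x hx
    exact Subtype.ext (h x x.2 fun j hj => congrFun hx ⟨j, hj⟩)
  refine (LinearMap.finrank_le_finrank_of_injective hinj).trans_eq ?_
  rw [Module.finrank_pi, Fintype.card_coe]

/-- A codeword vanishing off `M` is determined by its values on `M \ M'` and on the bits that the
decoder does not recover when `M'` is missing. -/
lemma finrank_shortenedCode_le (d : ErasureDecoder) (M M' : Finset (Fin n)) :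
    Module.finrank (ZMod 2) (shortenedCode H M) ≤ (d.unresolved H M').card + (M \ M').card := by
  refine (finrank_le_card_of_forall_eq_zero _ (d.unresolved H M' ∪ M \ M') ?_).trans
    (Finset.card_union_le _ _)
  intro x hx hT
  obtain ⟨hxC, hxM⟩ := mem_shortenedCode.1 hx
  funext j
  by_cases hj : d.Recovers H M' j
  · refine hj.mapRecovers x hxC 0 (zero_mem _) fun j' hj' => ?_
    by_cases hM : j' ∈ M
    · exact hT j' (Finset.mem_union_right _ (Finset.mem_sdiff.2 ⟨hM, hj'⟩))
    · exact hxM j' hM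
  · exact hT j (Finset.mem_union_left _ (ErasureDecoder.mem_unresolved.2 hj))

/-- Since `n - |M|` received bits cannot carry more than `n - |M|` dimensions, the bits left
unresolved make up for the rest. -/
lemma finrank_puncturedCode_empty_le (d : ErasureDecoder) (M : Finset (Fin n)) :
    (Module.finrank (ZMod 2) (puncturedCode H ∅) : ℝ) ≤ (d.unresolved H M).card + (n - M.card) := by
  have h0 := finrank_puncturedCode_add_finrank_shortenedCode H ∅
  have h1 := finrank_puncturedCode_add_finrank_shortenedCode H M
  have h2 := finrank_puncturedCode_le H M
  have h3 := finrank_shortenedCode_le H d M M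
  rw [Finset.sdiff_self, Finset.card_empty, add_zero] at h3
  have h4 : Mᶜ.card + M.card = n := by rw [Finset.card_compl_add_card, Fintype.card_fin]
  have h5 : Module.finrank (ZMod 2) (puncturedCode H ∅) + M.card ≤
    (d.unresolved H M).card + n := by omega
  have : (Module.finrank (ZMod 2) (puncturedCode H ∅) : ℝ) + M.card ≤
    (d.unresolved H M).card + n := by exact_mod_cast h5
  linarith

lemma abs_finrank_puncturedCode_sub_le (M : Finset (Fin n)) (k : ℝ) :
    |(Module.finrank (ZMod 2) (puncturedCode H M) : ℝ) - k| ≤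
      |(Module.finrank (ZMod 2) (puncturedCode H ∅) : ℝ) - k| +
        Module.finrank (ZMod 2) (shortenedCode H M) := by
  have h0 := finrank_puncturedCode_add_finrank_shortenedCode H ∅
  have h1 := finrank_puncturedCode_add_finrank_shortenedCode H M
  have h2 : Module.finrank (ZMod 2) (shortenedCode H ∅) = 0 := by
    refine Nat.le_zero.1 ((finrank_le_card_of_forall_eq_zero _ ∅ ?_).trans_eq Finset.card_empty)
    intro x hx _
    funext j
    exact (mem_shortenedCode.1 hx).2 j (Finset.notMem_empty j)
  have h3 : (Module.finrank (ZMod 2) (puncturedCode H M) : ℝ) +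
      Module.finrank (ZMod 2) (shortenedCode H M) =
        Module.finrank (ZMod 2) (puncturedCode H ∅) := by
    exact_mod_cast (by omega : Module.finrank (ZMod 2) (puncturedCode H M) +
      Module.finrank (ZMod 2) (shortenedCode H M) = Module.finrank (ZMod 2) (puncturedCode H ∅))
  have h4 : (0 : ℝ) ≤ Module.finrank (ZMod 2) (shortenedCode H M) := Nat.cast_nonneg _
  rw [abs_le]
  constructor <;>
    linarith [neg_abs_le ((Module.finrank (ZMod 2) (puncturedCode H ∅) : ℝ) - k),
      le_abs_self ((Module.finrank (ZMod 2) (puncturedCode H ∅) : ℝ) - k)]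

end dimension

/-! ### Averages over the ensemble -/

namespace CodeEnsemble

variable (𝓒 : CodeEnsemble)

lemma expect_mono {f g : Matrix (Fin 𝓒.m) (Fin 𝓒.n) (ZMod 2) → ℝ} (h : ∀ H, f H ≤ g H) :
    𝓒.expect f ≤ 𝓒.expect g :=
  Finset.sum_le_sum fun H _ => mul_le_mul_of_nonneg_left (h H) ENNReal.toReal_nonneg

lemma expect_const (a : ℝ) : 𝓒.expect (fun _ => a) = a := by
  have h := 𝓒.law.tsum_coe
  rw [tsum_fintype] at h
  rw [expect, ← Finset.sum_mul, ← ENNReal.toReal_sum fun H _ => 𝓒.law.apply_ne_top H, h,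
    ENNReal.toReal_one, one_mul]

lemma expect_nonneg {f : Matrix (Fin 𝓒.m) (Fin 𝓒.n) (ZMod 2) → ℝ} (h : ∀ H, 0 ≤ f H) :
    0 ≤ 𝓒.expect f :=
  (𝓒.expect_const 0).symm.le.trans (𝓒.expect_mono h)

lemma expect_add (f g : Matrix (Fin 𝓒.m) (Fin 𝓒.n) (ZMod 2) → ℝ) :
    𝓒.expect (fun H => f H + g H) = 𝓒.expect f + 𝓒.expect g := by
  simp only [expect, mul_add, Finset.sum_add_distrib]

lemma expect_mul_const (f : Matrix (Fin 𝓒.m) (Fin 𝓒.n) (ZMod 2) → ℝ) (a : ℝ) :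
    𝓒.expect (fun H => f H * a) = 𝓒.expect f * a := by
  simp only [expect, Finset.sum_mul, mul_assoc]

variable {𝓒} in
lemma Exchangeable.expect_submatrix (h : 𝓒.Exchangeable) (σ : Equiv.Perm (Fin 𝓒.n))
    (f : Matrix (Fin 𝓒.m) (Fin 𝓒.n) (ZMod 2) → ℝ) :
    𝓒.expect (fun H => f (H.submatrix id σ)) = 𝓒.expect f := by
  have hinj : Function.Injective
      fun H : Matrix (Fin 𝓒.m) (Fin 𝓒.n) (ZMod 2) => H.submatrix id σ := by
    intro H H' hH
    ext i j
    simpa using congrFun (congrFun hH i) (σ.symm j)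
  have hlaw : ∀ H, 𝓒.law (H.submatrix id σ) = 𝓒.law H := by
    intro H
    conv_lhs => rw [← h σ, PMF.map_apply]
    rw [tsum_eq_single H, if_pos rfl]
    exact fun H' hH' => if_neg fun he => hH' (hinj he.symm)
  have hbij := Finite.injective_iff_bijective.1 hinj
  rw [expect, expect, ← hbij.sum_comp fun H => (𝓒.law H).toReal * f H]
  exact Finset.sum_congr rfl fun H _ => by rw [hlaw]

/-- The loss in decoding when the positions in `M` are missing, averaged over the ensemble. -/
noncomputable def meanLoss (d : ErasureDecoder) (c : FailureCriterion) (M : Finset (Fin 𝓒.n)) : ℝ :=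
  𝓒.expect fun H => c.loss (d.unresolved H M)

/-- The dimension that puncturing at `M` loses, averaged over the ensemble and divided by the
length of the unpunctured code. -/
noncomputable def meanShortenedDim (M : Finset (Fin 𝓒.n)) : ℝ :=
  (𝓒.expect fun H => (Module.finrank (ZMod 2) (shortenedCode H M) : ℝ)) / 𝓒.n

section

variable (d : ErasureDecoder) (c : FailureCriterion)

lemma expect_failureRate (S : Finset (Fin 𝓒.n)) (ε : ℝ) :
    𝓒.expect (fun H => failureRate d c H S ε) = erasureMean (𝓒.meanLoss d c) S ε := by
  simp only [expect, failureRate, erasureMean, meanLoss, erasureWeight, Finset.mul_sum]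
  rw [Finset.sum_comm]
  exact Finset.sum_congr rfl fun E _ => Finset.sum_congr rfl fun H _ => by ring

lemma meanLoss_nonneg (M : Finset (Fin 𝓒.n)) : 0 ≤ 𝓒.meanLoss d c M :=
  𝓒.expect_nonneg fun _ => c.loss_nonneg _

lemma meanLoss_le_one (M : Finset (Fin 𝓒.n)) : 𝓒.meanLoss d c M ≤ 1 :=
  (𝓒.expect_mono fun _ => c.loss_le_one _).trans_eq (𝓒.expect_const 1)

lemma meanLoss_mono : Monotone (𝓒.meanLoss d c) := fun _ _ h =>
  𝓒.expect_mono fun H => c.loss_mono (d.unresolved_mono H h)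

variable {𝓒} in
lemma Exchangeable.meanLoss_map (h : 𝓒.Exchangeable) (σ : Equiv.Perm (Fin 𝓒.n))
    (M : Finset (Fin 𝓒.n)) :
    𝓒.meanLoss d c (M.map σ.toEmbedding) = 𝓒.meanLoss d c M := by
  rw [meanLoss, meanLoss, ← h.expect_submatrix σ fun H => c.loss (d.unresolved H M)]
  simp only [← ErasureDecoder.unresolved_submatrix, c.loss_map]

lemma meanShortenedDim_nonneg (M : Finset (Fin 𝓒.n)) : 0 ≤ 𝓒.meanShortenedDim M :=
  div_nonneg (𝓒.expect_nonneg fun _ => Nat.cast_nonneg _) (Nat.cast_nonneg _)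

lemma meanShortenedDim_le_one (M : Finset (Fin 𝓒.n)) : 𝓒.meanShortenedDim M ≤ 1 := by
  refine div_le_one_of_le₀ ?_ (Nat.cast_nonneg _)
  refine (𝓒.expect_mono fun H => Nat.cast_le.2 (Submodule.finrank_le _)).trans_eq ?_
  rw [𝓒.expect_const, Module.finrank_pi, Fintype.card_fin]

lemma meanShortenedDim_le (M M' : Finset (Fin 𝓒.n)) :
    𝓒.meanShortenedDim M ≤ 𝓒.meanLoss d c M' + ((M \ M').card : ℝ) / 𝓒.n := by
  rw [meanShortenedDim, div_eq_mul_inv, ← 𝓒.expect_mul_const, meanLoss,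
    ← 𝓒.expect_const (((M \ M').card : ℝ) / 𝓒.n), ← 𝓒.expect_add]
  refine 𝓒.expect_mono fun H => ?_
  rw [← div_eq_mul_inv]
  refine le_trans ?_ (add_le_add (c.card_div_le_loss _) le_rfl)
  rw [← add_div]
  exact div_le_div_of_nonneg_right (by exact_mod_cast finrank_shortenedCode_le H d M M')
    (Nat.cast_nonneg _)

/-- The converse bound at finite length: the missing positions, of mean number `|S| + ε (n - |S|)`,
and the dimension of the code cannot exceed `n` together, unless that many bits are unresolved. -/
lemma le_expect_failureRate (S : Finset (Fin 𝓒.n)) {ε : ℝ} (h0 : 0 ≤ ε) (h1 : ε ≤ 1) :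
    (𝓒.k - 𝓒.n + S.card + ε * (Sᶜ.card : ℝ) -
      𝓒.expect fun H => |(Module.finrank (ZMod 2) (puncturedCode H ∅) : ℝ) - 𝓒.k|) / 𝓒.n ≤
      𝓒.expect (fun H => failureRate d c H S ε) := by
  have hpt : ∀ M : Finset (Fin 𝓒.n), (𝓒.k - 𝓒.n + M.card -
      𝓒.expect fun H => |(Module.finrank (ZMod 2) (puncturedCode H ∅) : ℝ) - 𝓒.k|) / 𝓒.n ≤
        𝓒.meanLoss d c M := by
    intro M
    have h : 𝓒.expect (fun H => (𝓒.k - 𝓒.n + M.card : ℝ) / 𝓒.n) ≤ 𝓒.expect (fun H =>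
        c.loss (d.unresolved H M) +
          |(Module.finrank (ZMod 2) (puncturedCode H ∅) : ℝ) - 𝓒.k| * (𝓒.n : ℝ)⁻¹) := by
      refine 𝓒.expect_mono fun H => ?_
      refine le_trans ?_ (add_le_add (c.card_div_le_loss _) le_rfl)
      rw [← div_eq_mul_inv, ← add_div]
      refine div_le_div_of_nonneg_right ?_ (Nat.cast_nonneg _)
      linarith [finrank_puncturedCode_empty_le H d M,
        neg_abs_le ((Module.finrank (ZMod 2) (puncturedCode H ∅) : ℝ) - 𝓒.k)]
    rw [𝓒.expect_const, 𝓒.expect_add, 𝓒.expect_mul_const, ← div_eq_mul_inv] at h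
    rw [sub_div, meanLoss]
    linarith
  rw [expect_failureRate]
  refine le_trans (le_of_eq ?_) (erasureMean_mono h0 h1 hpt S)
  set a : ℝ := 𝓒.k - 𝓒.n + S.card -
    𝓒.expect fun H => |(Module.finrank (ZMod 2) (puncturedCode H ∅) : ℝ) - 𝓒.k| with ha
  have hE : ∀ E ∈ Sᶜ.powerset, erasureWeight Sᶜ ε E * ((𝓒.k - 𝓒.n + (S ∪ E).card -
      𝓒.expect fun H => |(Module.finrank (ZMod 2) (puncturedCode H ∅) : ℝ) - 𝓒.k|) / 𝓒.n) =
        (erasureWeight Sᶜ ε E * a + erasureWeight Sᶜ ε E * E.card) / 𝓒.n := by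
    intro E hE
    have hdisj : Disjoint S E :=
      disjoint_compl_right.mono_right (Finset.mem_powerset.1 hE)
    rw [Finset.card_union_of_disjoint hdisj, ha]
    push_cast
    ring
  rw [erasureMean, Finset.sum_congr rfl hE, ← Finset.sum_div, Finset.sum_add_distrib,
    ← Finset.sum_mul, sum_erasureWeight, sum_erasureWeight_card, ha]
  ring

end

end CodeEnsemble

/-! ### From averages to almost every choice -/

/-- If countably many functions with values in `[0, 1]` have averages tending to zero, then they
tend to zero simultaneously along every choice from sets of asymptotically full proportion. The
weighted sum `∑ j, 2⁻ʲ f j` has average `A` tending to zero, and by Markov's inequality it exceeds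
`√A` on a proportion of at most `√A`; this works along any filter. -/
lemma exists_subset_card_div_tendsto_one {ι : Type*} {l : Filter ι} {α : ι → Type*}
    (X : ∀ i, Finset (α i)) (hX : ∀ i, (X i).Nonempty) (f : ℕ → ∀ i, α i → ℝ)
    (h0 : ∀ j i x, 0 ≤ f j i x) (h1 : ∀ j i x, f j i x ≤ 1)
    (hlim : ∀ j, Tendsto (fun i => (∑ x ∈ X i, f j i x) / ((X i).card : ℝ)) l (𝓝 0)) :
    ∃ G : ∀ i, Finset (α i), (∀ i, G i ⊆ X i) ∧
      Tendsto (fun i => ((G i).card : ℝ) / ((X i).card : ℝ)) l (𝓝 1) ∧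
      ∀ x : ∀ i, α i, (∀ᶠ i in l, x i ∈ G i) →
        ∀ j, Tendsto (fun i => f j i (x i)) l (𝓝 0) := by
  classical
  have hcard : ∀ i, (0 : ℝ) < (X i).card := fun i => Nat.cast_pos.2 (hX i).card_pos
  have hsumm : ∀ i x, Summable fun j : ℕ => (1 / 2 : ℝ) ^ j * f j i x := fun i x =>
    Summable.of_nonneg_of_le (fun j => mul_nonneg (by positivity) (h0 j i x))
      (fun j => mul_le_of_le_one_right (by positivity) (h1 j i x)) summable_geometric_two
  set g : ∀ i, α i → ℝ := fun i x => ∑' j : ℕ, (1 / 2 : ℝ) ^ j * f j i x with hg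
  have hg0 : ∀ i x, 0 ≤ g i x := fun i x =>
    tsum_nonneg fun j => mul_nonneg (by positivity) (h0 j i x)
  have hfg : ∀ j i x, f j i x ≤ 2 ^ j * g i x := by
    intro j i x
    have := (hsumm i x).le_tsum j fun j' _ => mul_nonneg (by positivity) (h0 j' i x)
    calc f j i x = 2 ^ j * ((1 / 2 : ℝ) ^ j * f j i x) := by
          rw [← mul_assoc, ← mul_pow]; norm_num
      _ ≤ 2 ^ j * g i x := mul_le_mul_of_nonneg_left this (by positivity)
  set A : ι → ℝ := fun i => (∑ x ∈ X i, g i x) / ((X i).card : ℝ) with hA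
  have hA0 : ∀ i, 0 ≤ A i := fun i =>
    div_nonneg (Finset.sum_nonneg fun x _ => hg0 i x) (hcard i).le
  have hAlim : Tendsto A l (𝓝 0) := by
    have hAeq : A = fun i => ∑' j : ℕ, (1 / 2 : ℝ) ^ j * ((∑ x ∈ X i, f j i x) / (X i).card) := by
      funext i
      simp only [hA, hg]
      rw [← Summable.tsum_finsetSum fun x _ => hsumm i x, ← tsum_div_const]
      refine tsum_congr fun j => ?_
      rw [← Finset.mul_sum, mul_div_assoc]
    rw [hAeq, ← tsum_zero (α := ℝ) (β := ℕ)]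
    refine tendsto_tsum_of_dominated_convergence summable_geometric_two (fun j => ?_)
      (Eventually.of_forall fun i j => ?_)
    · simpa using (hlim j).const_mul ((1 / 2 : ℝ) ^ j)
    · have hs : 0 ≤ (∑ x ∈ X i, f j i x) / ((X i).card : ℝ) :=
        div_nonneg (Finset.sum_nonneg fun x _ => h0 j i x) (hcard i).le
      rw [Real.norm_of_nonneg (mul_nonneg (by positivity) hs)]
      refine mul_le_of_le_one_right (by positivity) (div_le_one_of_le₀ ?_ (hcard i).le)
      exact (Finset.sum_le_sum fun x _ => h1 j i x).trans_eq (by simp)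
  have hsqrt : Tendsto (fun i => √(A i)) l (𝓝 0) := by
    simpa using hAlim.sqrt
  refine ⟨fun i => (X i).filter fun x => g i x ≤ √(A i), fun i => Finset.filter_subset _ _,
    ?_, ?_⟩
  · have hlow : Tendsto (fun i => 1 - √(A i)) l (𝓝 1) := by simpa using hsqrt.const_sub 1
    refine tendsto_of_tendsto_of_tendsto_of_le_of_le hlow tendsto_const_nhds (fun i => ?_)
      fun i => div_le_one_of_le₀ (Nat.cast_le.2 (Finset.card_filter_le _ _)) (hcard i).le
    have hsplit : (((X i).filter fun x => g i x ≤ √(A i)).card : ℝ) +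
        ((X i).filter fun x => ¬ g i x ≤ √(A i)).card = (X i).card := by
      exact_mod_cast Finset.card_filter_add_card_filter_not (s := X i) fun x => g i x ≤ √(A i)
    have hbad : (((X i).filter fun x => ¬ g i x ≤ √(A i)).card : ℝ) ≤ √(A i) * (X i).card := by
      have hsum : ∑ x ∈ X i, g i x = √(A i) * √(A i) * (X i).card := by
        rw [Real.mul_self_sqrt (hA0 i), hA, div_mul_cancel₀ _ (hcard i).ne']
      rcases (Real.sqrt_nonneg (A i)).eq_or_lt with hz | hpos
      · rw [← hz, zero_mul, zero_mul, Finset.sum_eq_zero_iff_of_nonneg fun x _ => hg0 i x] at hsum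
        rw [← hz, zero_mul, Finset.filter_false_of_mem fun x hx => not_not.2 (hsum x hx).le,
          Finset.card_empty, Nat.cast_zero]
      · refine le_of_mul_le_mul_right ?_ hpos
        calc _ = ∑ x ∈ (X i).filter fun x => ¬ g i x ≤ √(A i), √(A i) := by
              rw [Finset.sum_const, nsmul_eq_mul]
          _ ≤ ∑ x ∈ (X i).filter fun x => ¬ g i x ≤ √(A i), g i x :=
              Finset.sum_le_sum fun x hx => (not_le.1 (Finset.mem_filter.1 hx).2).le
          _ ≤ ∑ x ∈ X i, g i x :=
              Finset.sum_le_sum_of_subset_of_nonneg (Finset.filter_subset _ _)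
                fun x _ _ => hg0 i x
          _ = _ := by rw [hsum]; ring
    rw [le_div_iff₀ (hcard i)]
    linarith
  · intro x hx j
    have hup : Tendsto (fun i => 2 ^ j * √(A i)) l (𝓝 0) := by
      simpa using hsqrt.const_mul ((2 : ℝ) ^ j)
    refine squeeze_zero' (Eventually.of_forall fun i => h0 j i _) ?_ hup
    filter_upwards [hx] with i hi
    exact (hfg j i (x i)).trans
      (mul_le_mul_of_nonneg_left (Finset.mem_filter.1 hi).2 (by positivity))

/-! ### Puncturing a fraction of the positions -/

section puncturing

variable {ι : Type*} {l : Filter ι} {n k : ι → ℕ} {R' : ℝ}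
  {ψ : ∀ i, Finset (Fin (n i)) → ℝ} {S : ∀ i, Finset (Fin (n i))}

lemma tendsto_card_compl_div (hn : Tendsto n l atTop)
    (hk : Tendsto (fun i => (k i : ℝ) / n i) l (𝓝 R')) (hS : ∀ᶠ i in l, (S i).card = k i) :
    Tendsto (fun i => ((S i)ᶜ.card : ℝ) / n i) l (𝓝 (1 - R')) := by
  refine (hk.const_sub 1).congr' ?_
  filter_upwards [hS, hn.eventually_gt_atTop 0] with i hi hpos
  have hpos' : (0 : ℝ) < n i := Nat.cast_pos.2 hpos
  have h : ((S i)ᶜ.card : ℝ) + (S i).card = n i := by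
    exact_mod_cast (Finset.card_compl_add_card (S i)).trans (Fintype.card_fin _)
  rw [eq_div_iff hpos'.ne', sub_mul, div_mul_cancel₀ _ hpos'.ne', ← hi]
  linarith

/-- The missing fraction `R' + ε (1 - R')` is below the threshold `1 - R'` of the unpunctured code
exactly when `ε < 1 - R' / (1 - R')`. -/
lemma tendsto_erasureMean_of_rate [l.NeBot] (hR0 : 0 ≤ R') (hR' : R' ≤ 1 / 2)
    (hcard : ∀ i, ∀ M M' : Finset (Fin (n i)), M.card ≤ M'.card → ψ i M ≤ ψ i M')
    (hψ0 : ∀ i M, 0 ≤ ψ i M) (hψ1 : ∀ i M, ψ i M ≤ 1) (hn : Tendsto n l atTop)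
    (hk : Tendsto (fun i => (k i : ℝ) / n i) l (𝓝 R'))
    (hlim : ∀ ε, 0 ≤ ε → ε < 1 - R' → Tendsto (fun i => erasureMean (ψ i) ∅ ε) l (𝓝 0))
    (hS : ∀ᶠ i in l, (S i).card = k i) {ε : ℝ} (h0 : 0 ≤ ε) (hε : ε < 1 - R' / (1 - R')) :
    Tendsto (fun i => erasureMean (ψ i) (S i) ε) l (𝓝 0) := by
  have hR1 : 0 < 1 - R' := by linarith
  have hlt : R' + ε * (1 - R') < 1 - R' := by
    have := mul_lt_mul_of_pos_right hε hR1
    rw [sub_mul, div_mul_cancel₀ _ hR1.ne'] at this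
    linarith
  obtain ⟨τ, hτ, hτ'⟩ := exists_between hlt
  have h1 : ε ≤ 1 := by
    have : 0 ≤ R' / (1 - R') := div_nonneg hR0 hR1.le
    linarith
  refine tendsto_erasureMean hcard hψ0 hψ1 hn (by linarith) hlim S h0 h1 hτ' ?_
  have hfrac := hk.add ((tendsto_card_compl_div hn hk hS).const_mul ε)
  filter_upwards [hfrac.eventually (gt_mem_nhds hτ), hS, hn.eventually_gt_atTop 0]
    with i hi hc hpos
  have hpos' : (0 : ℝ) < n i := Nat.cast_pos.2 hpos
  rw [← mul_div_assoc, ← add_div, div_lt_iff₀ hpos'] at hi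
  rw [hc]
  exact hi.le

/-- For `R' = 1 / 2` the set `S i` itself may exceed the threshold, so a small fraction of it is
given up before the threshold is used. -/
lemma tendsto_zero_of_le_add_card_sdiff [l.NeBot] (hR' : R' ≤ 1 / 2) (hR0 : 0 ≤ R')
    (hcard : ∀ i, ∀ M M' : Finset (Fin (n i)), M.card ≤ M'.card → ψ i M ≤ ψ i M')
    (hψ0 : ∀ i M, 0 ≤ ψ i M) (hψ1 : ∀ i M, ψ i M ≤ 1) (hn : Tendsto n l atTop)
    (hkn : ∀ i, k i ≤ n i) (hk : Tendsto (fun i => (k i : ℝ) / n i) l (𝓝 R'))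
    (hlim : ∀ ε, 0 ≤ ε → ε < 1 - R' → Tendsto (fun i => erasureMean (ψ i) ∅ ε) l (𝓝 0))
    (hS : ∀ i, (S i).card = k i) {a : ι → ℝ} (ha0 : ∀ i, 0 ≤ a i)
    (ha : ∀ i, ∀ M ⊆ S i, a i ≤ ψ i M + ((S i \ M).card : ℝ) / n i) :
    Tendsto a l (𝓝 0) := by
  rw [Metric.tendsto_nhds]
  intro b hb
  obtain ⟨δ, hδ0, hδ⟩ : ∃ δ : ℝ, 0 < δ ∧ δ < min 1 (b / 3) :=
    exists_between (lt_min one_pos (by positivity))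
  have hδ1 : δ < 1 := hδ.trans_le (min_le_left _ _)
  have hδb : δ < b / 3 := hδ.trans_le (min_le_right _ _)
  have hsub : ∀ i, ∃ M ⊆ S i, M.card = ⌊(1 - δ) * k i⌋₊ := fun i =>
    Finset.exists_subset_card_eq (by
      rw [hS i]
      exact Nat.floor_le_of_le
        (mul_le_of_le_one_left (Nat.cast_nonneg _) (by linarith)))
  choose M hMS hM using hsub
  have hfloor : ∀ i, (M i).card ≤ (1 - δ) * (k i : ℝ) := fun i => by
    rw [hM i]
    exact Nat.floor_le (mul_nonneg (by linarith) (Nat.cast_nonneg _))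
  have hψM : Tendsto (fun i => ψ i (M i)) l (𝓝 0) := by
    have hτ : (1 - δ) * (1 / 2 + δ / 4) < 1 - R' := by nlinarith
    have := tendsto_erasureMean hcard hψ0 hψ1 hn (by linarith) hlim M le_rfl zero_le_one hτ ?_
    · simpa only [erasureMean_zero] using this
    · filter_upwards [hk.eventually (gt_mem_nhds (by linarith : R' < 1 / 2 + δ / 4)),
        hn.eventually_gt_atTop 0] with i hi hpos
      rw [div_lt_iff₀ (Nat.cast_pos.2 hpos)] at hi
      have := mul_le_mul_of_nonneg_left hi.le (by linarith : 0 ≤ 1 - δ)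
      linarith [hfloor i]
  have hinv : Tendsto (fun i => (1 : ℝ) / n i) l (𝓝 0) :=
    (tendsto_natCast_atTop_atTop.comp hn).const_div_atTop 1
  filter_upwards [hψM.eventually (gt_mem_nhds (by positivity : 0 < b / 3)),
    hinv.eventually (gt_mem_nhds (by positivity : 0 < b / 3)), hn.eventually_gt_atTop 0]
    with i h1 h2 hpos
  have hpos' : (0 : ℝ) < n i := Nat.cast_pos.2 hpos
  have hcount : ((S i \ M i).card : ℝ) ≤ δ * n i + 1 := by
    rw [Finset.cast_card_sdiff (hMS i), hS i, hM i]
    have := Nat.lt_floor_add_one ((1 - δ) * (k i : ℝ))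
    have := mul_le_mul_of_nonneg_left (Nat.cast_le.2 (hkn i) : (k i : ℝ) ≤ n i) hδ0.le
    linarith
  have hdiv : ((S i \ M i).card : ℝ) / n i ≤ δ + 1 / n i := by
    rw [div_le_iff₀ hpos', add_mul, div_mul_cancel₀ _ hpos'.ne']
    exact hcount
  rw [Real.dist_0_eq_abs, abs_of_nonneg (ha0 i)]
  linarith [ha i (M i) (hMS i)]

end puncturing

/-! ### Punctured capacity-achieving codes -/

namespace CapacityAchieving

variable {ι : Type*} {l : Filter ι} {d : ErasureDecoder} {c : FailureCriterion}
  {𝓒 : ι → CodeEnsemble} {R' : ℝ}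

lemma tendsto_n (h : CapacityAchieving l d c 𝓒 (fun _ => ∅) R') :
    Tendsto (fun i => (𝓒 i).n) l atTop := by
  simpa using h.length

lemma tendsto_k_div_n (h : CapacityAchieving l d c 𝓒 (fun _ => ∅) R') :
    Tendsto (fun i => ((𝓒 i).k : ℝ) / (𝓒 i).n) l (𝓝 R') := by
  simpa using h.rate

lemma tendsto_dimension (h : CapacityAchieving l d c 𝓒 (fun _ => ∅) R') :
    Tendsto (fun i => (𝓒 i).expect (fun H =>
      |(Module.finrank (ZMod 2) (puncturedCode H ∅) : ℝ) - ((𝓒 i).k : ℝ)|) / (𝓒 i).n) l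
        (𝓝 0) := by
  simpa using h.dimension

lemma tendsto_erasureMean_meanLoss (h : CapacityAchieving l d c 𝓒 (fun _ => ∅) R') (ε : ℝ)
    (h0 : 0 ≤ ε) (h1 : ε < 1 - R') :
    Tendsto (fun i => erasureMean ((𝓒 i).meanLoss d c) ∅ ε) l (𝓝 0) := by
  simpa only [CodeEnsemble.expect_failureRate] using h.success ε h0 h1

lemma rate_nonneg [l.NeBot] (h : CapacityAchieving l d c 𝓒 (fun _ => ∅) R') : 0 ≤ R' :=
  ge_of_tendsto' h.tendsto_k_div_n fun _ => div_nonneg (Nat.cast_nonneg _) (Nat.cast_nonneg _)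

/-- Along the trivial filter every limit statement holds. -/
lemma of_bot {S : ∀ i, Finset (Fin (𝓒 i).n)} {R : ℝ} : CapacityAchieving ⊥ d c 𝓒 S R :=
  ⟨tendsto_bot, tendsto_bot, tendsto_bot, fun _ _ _ => tendsto_bot⟩

/-- Puncturing `k` positions keeps the code capacity-achieving as soon as the decoder copes with it
and it costs no dimension to first order. -/
lemma punctured [l.NeBot] (h : CapacityAchieving l d c 𝓒 (fun _ => ∅) R') (hR' : R' ≤ 1 / 2)
    {S : ∀ i, Finset (Fin (𝓒 i).n)} (hS : ∀ᶠ i in l, (S i).card = (𝓒 i).k)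
    (hdim : Tendsto (fun i => (𝓒 i).meanShortenedDim (S i)) l (𝓝 0))
    (hsucc : ∀ ε : ℝ, 0 ≤ ε → ε < 1 - R' / (1 - R') →
      Tendsto (fun i => erasureMean ((𝓒 i).meanLoss d c) (S i) ε) l (𝓝 0)) :
    CapacityAchieving l d c 𝓒 S (R' / (1 - R')) := by
  have hR1 : 0 < 1 - R' := by linarith
  have hN := tendsto_card_compl_div h.tendsto_n h.tendsto_k_div_n hS
  have hpos : ∀ᶠ i in l, (0 : ℝ) < (𝓒 i).n := by
    filter_upwards [h.tendsto_n.eventually_gt_atTop 0] with i hi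
    exact Nat.cast_pos.2 hi
  refine ⟨?_, ?_, ?_, fun ε h0 h1 => ?_⟩
  · rw [← tendsto_natCast_atTop_iff (R := ℝ)]
    refine (hN.pos_mul_atTop hR1 (tendsto_natCast_atTop_atTop.comp h.tendsto_n)).congr' ?_
    filter_upwards [hpos] with i hi
    exact div_mul_cancel₀ _ hi.ne'
  · refine (h.tendsto_k_div_n.div hN hR1.ne').congr' ?_
    filter_upwards [hpos] with i hi
    exact div_div_div_cancel_right₀ hi.ne' _ _
  · have hup := (h.tendsto_dimension.add hdim).div hN hR1.ne'
    rw [add_zero, zero_div] at hup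
    refine squeeze_zero' (Eventually.of_forall fun i => div_nonneg
      ((𝓒 i).expect_nonneg fun H => abs_nonneg _) (Nat.cast_nonneg _)) ?_ hup
    filter_upwards [hpos] with i hi
    rw [Pi.div_apply, CodeEnsemble.meanShortenedDim, ← add_div, div_div_div_cancel_right₀ hi.ne',
      ← CodeEnsemble.expect_add]
    exact div_le_div_of_nonneg_right
      ((𝓒 i).expect_mono fun H => abs_finrank_puncturedCode_sub_le H _ _) (Nat.cast_nonneg _)
  · simpa only [CodeEnsemble.expect_failureRate] using hsucc ε h0 h1

lemma punctured_of_exchangeable [l.NeBot] (h : CapacityAchieving l d c 𝓒 (fun _ => ∅) R')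
    (hR' : R' ≤ 1 / 2) (hex : ∀ i, (𝓒 i).Exchangeable) (S : ∀ i, Finset (Fin (𝓒 i).n))
    (hS : ∀ i, (S i).card = (𝓒 i).k) :
    CapacityAchieving l d c 𝓒 S (R' / (1 - R')) := by
  have hcard : ∀ i, ∀ M M' : Finset (Fin (𝓒 i).n), M.card ≤ M'.card →
      (𝓒 i).meanLoss d c M ≤ (𝓒 i).meanLoss d c M' := fun i =>
    le_of_card_le ((𝓒 i).meanLoss_mono d c) ((hex i).meanLoss_map d c)
  have hS' := Eventually.of_forall (f := l) hS
  refine h.punctured hR' hS' ?_ fun ε h0 h1 => ?_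
  · exact tendsto_zero_of_le_add_card_sdiff hR' h.rate_nonneg hcard
      (fun i => (𝓒 i).meanLoss_nonneg d c) (fun i => (𝓒 i).meanLoss_le_one d c) h.tendsto_n
      (fun i => (𝓒 i).k_le) h.tendsto_k_div_n h.tendsto_erasureMean_meanLoss hS
      (fun i => (𝓒 i).meanShortenedDim_nonneg _)
      (fun i M _ => (𝓒 i).meanShortenedDim_le d c (S i) M)
  · exact tendsto_erasureMean_of_rate h.rate_nonneg hR' hcard
      (fun i => (𝓒 i).meanLoss_nonneg d c) (fun i => (𝓒 i).meanLoss_le_one d c) h.tendsto_n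
      h.tendsto_k_div_n h.tendsto_erasureMean_meanLoss hS' h0 h1

/-- Averaging over all permutations makes the mean loss invariant, without changing it for the
unpunctured code; this averages over the punctured sets. -/
lemma punctured_of_almost_all [l.NeBot] (h : CapacityAchieving l d c 𝓒 (fun _ => ∅) R')
    (hR' : R' ≤ 1 / 2) :
    ∃ 𝓖 : ∀ i, Finset (Finset (Fin (𝓒 i).n)),
      (∀ i, ∀ T ∈ 𝓖 i, T.card = (𝓒 i).k) ∧
      Tendsto (fun i => ((𝓖 i).card : ℝ) / ((𝓒 i).n.choose (𝓒 i).k : ℝ)) l (𝓝 1) ∧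
      ∀ S : ∀ i, Finset (Fin (𝓒 i).n), (∀ᶠ i in l, S i ∈ 𝓖 i) →
        CapacityAchieving l d c 𝓒 S (R' / (1 - R')) := by
  have hex : ∀ i, ∃ T : Finset (Fin (𝓒 i).n), T.card = (𝓒 i).k := fun i => by
    obtain ⟨T, -, hT⟩ := Finset.exists_subset_card_eq
      (s := (Finset.univ : Finset (Fin (𝓒 i).n))) (n := (𝓒 i).k) (by simpa using (𝓒 i).k_le)
    exact ⟨T, hT⟩
  choose T hT using hex
  set ψ : ∀ i, Finset (Fin (𝓒 i).n) → ℝ := fun i => permAverage ((𝓒 i).meanLoss d c) with hψ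
  have hψ0 : ∀ i M, 0 ≤ ψ i M := fun i => permAverage_nonneg ((𝓒 i).meanLoss_nonneg d c)
  have hψ1 : ∀ i M, ψ i M ≤ 1 := fun i => permAverage_le_one ((𝓒 i).meanLoss_le_one d c)
  have hcard : ∀ i, ∀ M M' : Finset (Fin (𝓒 i).n), M.card ≤ M'.card → ψ i M ≤ ψ i M' :=
    fun i => le_of_card_le (permAverage_mono ((𝓒 i).meanLoss_mono d c)) permAverage_map
  have hlim : ∀ ε, 0 ≤ ε → ε < 1 - R' → Tendsto (fun i => erasureMean (ψ i) ∅ ε) l (𝓝 0) := by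
    intro ε h0 h1
    refine (h.tendsto_erasureMean_meanLoss ε h0 h1).congr fun i => ?_
    rw [hψ, ← permAverage_erasureMean]
    simp only [permAverage, Finset.map_empty]
    rw [Finset.sum_const, Finset.card_univ, nsmul_eq_mul,
      mul_div_cancel_left₀ _ (Nat.cast_ne_zero.2 Fintype.card_ne_zero)]
  have hR0 := h.rate_nonneg
  set p : ℕ → ℝ := fun j => 1 - R' / (1 - R') - 1 / ((j : ℝ) + 1) with hp
  have hp_lt : ∀ j, p j < 1 - R' / (1 - R') := fun j =>
    sub_lt_self _ (by positivity)
  have hp_le : ∀ j, p j ≤ 1 := fun j => by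
    have : 0 ≤ R' / (1 - R') := div_nonneg hR0 (by linarith)
    linarith [hp_lt j]
  -- the quantities that have to vanish, for a sequence of erasure probabilities `p j` that
  -- increases to `1 - R`; negative `p j` are disregarded
  let f : ℕ → ∀ i, Finset (Fin (𝓒 i).n) → ℝ := fun j i S =>
    Nat.casesOn j ((𝓒 i).meanShortenedDim S) fun j =>
      if 0 ≤ p j then erasureMean ((𝓒 i).meanLoss d c) S (p j) else 0
  obtain ⟨𝓖, hsub, hratio, hconv⟩ := exists_subset_card_div_tendsto_one (l := l)
    (fun i => Finset.powersetCard (𝓒 i).k (Finset.univ : Finset (Fin (𝓒 i).n)))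
    (fun i => Finset.powersetCard_nonempty.2 (by simpa using (𝓒 i).k_le)) f
    (by
      rintro (_ | j) i S
      · exact (𝓒 i).meanShortenedDim_nonneg S
      · by_cases hj : 0 ≤ p j
        · simpa [f, hj] using erasureMean_nonneg hj (hp_le j) ((𝓒 i).meanLoss_nonneg d c) S
        · simp [f, hj])
    (by
      rintro (_ | j) i S
      · exact (𝓒 i).meanShortenedDim_le_one S
      · by_cases hj : 0 ≤ p j
        · simpa [f, hj] using erasureMean_le_one hj (hp_le j) ((𝓒 i).meanLoss_le_one d c) S
        · simp [f, hj])
    (by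
      intro j
      have havg : ∀ i, (∑ S ∈ Finset.powersetCard (𝓒 i).k Finset.univ, f j i S) /
          ((Finset.powersetCard (𝓒 i).k (Finset.univ : Finset (Fin (𝓒 i).n))).card : ℝ) =
            permAverage (f j i) (T i) := fun i => by
        rw [← sum_powersetCard_div_choose, hT i, Finset.card_powersetCard, Finset.card_univ,
          Fintype.card_fin]
      simp only [havg]
      rcases j with _ | j
      · refine tendsto_zero_of_le_add_card_sdiff hR' hR0 hcard hψ0 hψ1 h.tendsto_n
          (fun i => (𝓒 i).k_le) h.tendsto_k_div_n hlim hT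
          (fun i => permAverage_nonneg ((𝓒 i).meanShortenedDim_nonneg) _) fun i M _ => ?_
        rw [hψ, ← permAverage_add_const]
        refine permAverage_le_permAverage fun σ => ?_
        refine ((𝓒 i).meanShortenedDim_le d c _ (M.map σ.toEmbedding)).trans_eq ?_
        rw [← Finset.map_sdiff, Finset.card_map]
      · by_cases hj : 0 ≤ p j
        · simp only [f, hj, if_true, permAverage_erasureMean]
          exact tendsto_erasureMean_of_rate hR0 hR' hcard hψ0 hψ1 h.tendsto_n h.tendsto_k_div_n
            hlim (Eventually.of_forall hT) hj (hp_lt j)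
        · simp only [f, hj, if_false, permAverage_const]
          exact tendsto_const_nhds)
  refine ⟨𝓖, fun i S hS => (Finset.mem_powersetCard.1 (hsub i hS)).2, ?_, fun S hS => ?_⟩
  · simpa using hratio
  · refine h.punctured hR' ?_ (hconv S hS 0) fun ε h0 h1 => ?_
    · filter_upwards [hS] with i hi
      exact (Finset.mem_powersetCard.1 (hsub i hi)).2
    · obtain ⟨j, hj⟩ := exists_nat_one_div_lt (sub_pos.2 h1)
      have hεp : ε ≤ p j := by simp only [hp]; linarith
      have hlimj := hconv S hS (j + 1)
      simp only [f, h0.trans hεp, if_true] at hlimj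
      exact squeeze_zero
        (fun i => erasureMean_nonneg h0 (hεp.trans (hp_le j)) ((𝓒 i).meanLoss_nonneg d c) _)
        (fun i => erasureMean_mono_prob ((𝓒 i).meanLoss_mono d c) h0 hεp (hp_le j) (S i)) hlimj

lemma exists_le_expect_failureRate [l.NeBot] (h : CapacityAchieving l d c 𝓒 (fun _ => ∅) R')
    (hR' : R' ≤ 1 / 2) (S : ∀ i, Finset (Fin (𝓒 i).n)) (hS : ∀ i, (S i).card = (𝓒 i).k) (ε : ℝ)
    (hε : 1 - R' / (1 - R') < ε) (h1 : ε ≤ 1) :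
    ∃ δ : ℝ, 0 < δ ∧ ∀ᶠ i in l, δ ≤ (𝓒 i).expect (fun H => failureRate d c H (S i) ε) := by
  have hR1 : 0 < 1 - R' := by linarith
  have h0 : 0 ≤ ε := by
    have : R' / (1 - R') ≤ 1 := div_le_one_of_le₀ (by linarith) hR1.le
    linarith
  have hpos : 0 < R' - 1 + R' + ε * (1 - R') - 0 := by
    have := mul_lt_mul_of_pos_right hε hR1
    rw [sub_mul, div_mul_cancel₀ _ hR1.ne'] at this
    linarith
  have hlim := (((h.tendsto_k_div_n.sub_const 1).add h.tendsto_k_div_n).add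
    ((tendsto_card_compl_div h.tendsto_n h.tendsto_k_div_n (Eventually.of_forall hS)).const_mul
      ε)).sub h.tendsto_dimension
  refine ⟨_, half_pos hpos, ?_⟩
  filter_upwards [hlim.eventually (lt_mem_nhds (half_lt_self hpos)),
    h.tendsto_n.eventually_gt_atTop 0] with i hi hn
  have hn' : ((𝓒 i).n : ℝ) ≠ 0 := Nat.cast_ne_zero.2 hn.ne'
  refine hi.le.trans (le_trans (le_of_eq ?_) ((𝓒 i).le_expect_failureRate d c (S i) h0 h1))
  rw [hS i]
  field_simp

end CapacityAchieving

theorem proposition1 {ι : Type*} (l : Filter ι) (d : ErasureDecoder) (c : FailureCriterion)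
    (𝓒 : ι → CodeEnsemble) (R' : ℝ) (hR' : R' ≤ 1 / 2)
    (hcap : CapacityAchieving l d c 𝓒 (fun _ => ∅) R') :
    -- if the positions are exchangeable: puncture any `k` bits
    ((∀ i, (𝓒 i).Exchangeable) →
      ∀ S : ∀ i, Finset (Fin (𝓒 i).n), (∀ i, (S i).card = (𝓒 i).k) →
        CapacityAchieving l d c 𝓒 S (R' / (1 - R'))) ∧
    -- for arbitrary codes: puncture any `k` bits outside a vanishing proportion of choices
    (∃ 𝓖 : ∀ i, Finset (Finset (Fin (𝓒 i).n)),
      (∀ i, ∀ T ∈ 𝓖 i, T.card = (𝓒 i).k) ∧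
      Tendsto (fun i => ((𝓖 i).card : ℝ) / ((𝓒 i).n.choose (𝓒 i).k : ℝ)) l (𝓝 1) ∧
      ∀ S : ∀ i, Finset (Fin (𝓒 i).n), (∀ᶠ i in l, S i ∈ 𝓖 i) →
        CapacityAchieving l d c 𝓒 S (R' / (1 - R'))) ∧
    -- and, whichever `k` bits are punctured, decoding fails for `ε > 1 - R`
    (∀ S : ∀ i, Finset (Fin (𝓒 i).n), (∀ i, (S i).card = (𝓒 i).k) →
      ∀ ε : ℝ, 1 - R' / (1 - R') < ε → ε ≤ 1 →
        ∃ δ : ℝ, 0 < δ ∧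
          ∀ᶠ i in l, δ ≤ (𝓒 i).expect (fun H => failureRate d c H (S i) ε)) := by
  rcases l.eq_or_neBot with rfl | hl
  · exact ⟨fun _ _ _ => .of_bot, ⟨fun i => Finset.powersetCard (𝓒 i).k Finset.univ,
      fun i T hT => (Finset.mem_powersetCard.1 hT).2, tendsto_bot, fun _ _ => .of_bot⟩,
      fun _ _ _ _ _ => ⟨1, one_pos, eventually_bot⟩⟩
  · exact ⟨hcap.punctured_of_exchangeable hR', hcap.punctured_of_almost_all hR',
      hcap.exists_le_expect_failureRate hR'⟩
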